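/- \textbf{Corollary (Receive SNRs, spherical array).} Let $\lambda,P_t,\sigma,E>0$, let $M\ge 0$ be an integer, and let $Y_\ell^m$ be the orthonormal spherical harmonics in azimuth $\varphi$ and polar angle $\theta$. A continuous spherical array of radius $r_0$ around the origin serves users $X_1,\dots,X_U\in\mathbb R^3$, $r_u=|X_u|$, with $2\max_u r_u\le r_0$. The channel from the array element $A$ to user $u$ is $h_u(A)=\frac{1}{\sqrt{4\pi}\,|X_u-A|}e^{-j\frac{2\pi}{\lambda}|X_u-A|}$. Multiuser phase-mode (MU-PM) transmission uses for user $u$ the precoder $$\tilde f'_u=\frac{h_u^*}{|h_u|}\sum_{\ell=0}^{M}\sum_{m=-\ell}^{\ell}c_{u,m,\ell}\,Y_\ell^m,\qquad \sum_{\ell,m}|c_{u,m,\ell}|^2\le E ,$$ and user $u$ receives $$y_u=\frac{\lambda}{\sqrt{4\pi}}\sqrt{\frac{P_t}{4\pi r_0^2}}\int_{|A|=r_0}h_u(A)\sum_{k=1}^U\tilde f'_k(A)\,x_k\,dA+z_u,\qquad x_k\sim\mathcal{CN}(0,1),\ z_u\sim\mathcal{CN}(0,\sigma^2).$$ The receive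 SNR of user $u$ is the expected power of the part of $y_u$ carrying $x_u$ divided by the noise power $\sigma^2$. With $\psi_u$ the angle between $X_u$ and the direction $(\varphi,\theta)$, put $$\mathcal J_{u,k,m,\ell}=\int_0^{2\pi}\!\!\int_0^{\pi}e^{j\frac{2\pi}{\lambda}(r_u\cos\psi_u-r_k\cos\psi_k)}\,Y_\ell^m(\varphi,\theta)\sin\theta\,d\theta\,d\varphi ,$$ let $\tilde{\mathcal J}_u$ be the matrix with rows $k\ne u$, columns $(\ell,m)$ ($0\le\ell\le M$, $-\ell\le m\le\ell$) and entries $\mathcal J_{u,k,m,\ell}$, and let $e_0$ be the unit vector of the mode $(0,0)$. The coefficients satisfy the zero-forcing constraints $\sum_{\ell,m}c_{k,m,\ell}\,\mathcal J_{u,k,m,\ell}=0$ for all $u$ and all $k\neq u$. Then for every user $u$ the maximum of the receive SNR of user $u$ over all such coefficients exists and equals $$\mathsf{SNR}_u=\frac{\eta^2P_t\,|e_0^\dagger b_u|^2}{\sigma^2}+o,\qquad \eta=\frac{\lambda\sqrt E}{4\pi},\qquad |o|\le C\,\frac{\max_k r_k}{r_0},$$ where $b_u$ is a matrix whose columns form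 any orthonormal basis of $\mathrm{null}(\tilde{\mathcal J}_u)$, $|e_0^\dagger b_u|$ is the Euclidean norm of the row vector $e_0^\dagger b_u$, and $C$ depends only on $M,\lambda,P_t,\sigma,E$. In particular $\eta=\lambda/(4\pi)$ for the coefficient normalization $E=1$, and $\eta=\lambda/\sqrt{4\pi}$ for $E=4\pi$, which is the normalization $\frac1{4\pi}\int_0^{2\pi}\!\int_0^\pi|\tilde f_u'|^2\sin\theta\,d\theta\,d\varphi\le 1$ (total transmit power of user $u$ at most $P_t$). -/

import Mathlib

namespace SphUA

open scoped Real
open MeasureTheory Complex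

/-- Euclidean three-space, in which the array and the users live. -/
abbrev Space : Type := EuclideanSpace ℝ (Fin 3)

/-- The unit vector with azimuth angle `φ` and polar angle `θ`. -/
noncomputable def dir (φ θ : ℝ) : Space :=
  !₂[Real.sin θ * Real.cos φ, Real.sin θ * Real.sin φ, Real.cos θ]

/-- The element in direction `(φ, θ)` of the spherical array of radius `r₀` around the origin. -/
noncomputable def element (r₀ φ θ : ℝ) : Space := r₀ • dir φ θ

/-- Integral over the unit sphere in spherical coordinates: `∬ F(φ, θ) sin θ dθ dφ`. -/
noncomputable def sphereIntegral (F : ℝ → ℝ → ℂ) : ℂ :=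
  ∫ φ in (0 : ℝ)..(2 * π), ∫ θ in (0 : ℝ)..π, F φ θ * (Real.sin θ : ℂ)

/-! ### Spherical harmonics -/

/-- The associated Legendre function
`P_ℓ^m(x) = (-1)^m / (2^ℓ ℓ!) · (1 - x²)^(m/2) · (d/dx)^(m+ℓ) (x² - 1)^ℓ`, for `-ℓ ≤ m ≤ ℓ`. -/
noncomputable def assocLegendre (ℓ : ℕ) (m : ℤ) (x : ℝ) : ℝ :=
  (-1 : ℝ) ^ m / (2 ^ ℓ * (ℓ.factorial : ℝ)) * (1 - x ^ 2) ^ ((m : ℝ) / 2) *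
    (Polynomial.derivative^[(m + ℓ).toNat]
      (((Polynomial.X : Polynomial ℝ) ^ 2 - 1) ^ ℓ)).eval x

/-- The orthonormal spherical harmonic `Y_ℓ^m(φ, θ)`, for `-ℓ ≤ m ≤ ℓ`. -/
noncomputable def sphHarm (ℓ : ℕ) (m : ℤ) (φ θ : ℝ) : ℂ :=
  ((√((2 * (ℓ : ℝ) + 1) / (4 * π) *
      ((((ℓ : ℤ) - m).toNat.factorial : ℝ) / (((ℓ : ℤ) + m).toNat.factorial : ℝ))) *
    assocLegendre ℓ m (Real.cos θ) : ℝ) : ℂ) * Complex.exp (I * ((m : ℂ) * (φ : ℂ)))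

/-- The phase modes in use: pairs `(ℓ, m)` with `0 ≤ ℓ ≤ M` and `-ℓ ≤ m ≤ ℓ`;
the second component `i` encodes `m = i - ℓ`. -/
abbrev Mode (M : ℕ) : Type := Σ ℓ : Fin (M + 1), Fin (2 * (ℓ : ℕ) + 1)

/-- The order `m` of a mode. -/
def Mode.order {M : ℕ} (p : Mode M) : ℤ := ((p.2 : ℕ) : ℤ) - ((p.1 : ℕ) : ℤ)

/-- The mode `(ℓ, m) = (0, 0)`. -/
def Mode.zero (M : ℕ) : Mode M := ⟨0, 0⟩

/-- The spherical harmonic of a mode. -/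
noncomputable def Mode.harm {M : ℕ} (p : Mode M) (φ θ : ℝ) : ℂ := sphHarm (p.1 : ℕ) p.order φ θ

/-- Coefficient vectors indexed by the modes, with the Euclidean norm. -/
abbrev Coeff (M : ℕ) : Type := EuclideanSpace ℂ (Mode M)

/-- The vector `e₀` that selects the mode `(0, 0)`. -/
noncomputable def e₀ (M : ℕ) : Coeff M := EuclideanSpace.single (Mode.zero M) (1 : ℂ)

/-! ### System model -/

/-- Free-space channel response between a user at `x` and an array element at `a`, for the
wavelength `lam`. -/
noncomputable def channel (lam : ℝ) (x a : Space) : ℂ :=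
  (1 / (√(4 * π) * dist x a) : ℝ) * Complex.exp (-I * ((2 * π / lam * dist x a : ℝ) : ℂ))

/-- Channel-conjugate precoder for a user at `x`. -/
noncomputable def conjPrecoder (lam r₀ : ℝ) (x : Space) (φ θ : ℝ) : ℂ :=
  (starRingEnd ℂ) (channel lam x (element r₀ φ θ)) / (‖channel lam x (element r₀ φ θ)‖ : ℂ)

/-- Multiuser phase-mode precoder for a user at `x` with coefficient vector `c`. -/
noncomputable def precoder {M : ℕ} (lam r₀ : ℝ) (x : Space) (c : Coeff M) (φ θ : ℝ) : ℂ :=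
  conjPrecoder lam r₀ x φ θ * ∑ p : Mode M, c p * p.harm φ θ

/-- Incident field at user `u`: `√(P_t / area) ∫ h_u(A) ∑ₖ f_k(A) x_k dA` over the sphere of
radius `r₀`, whose area is `4 π r₀²` and whose surface element is `r₀² sin θ dθ dφ`. -/
noncomputable def field {U M : ℕ} (lam Pt r₀ : ℝ) (X : Fin U → Space) (c : Fin U → Coeff M)
    (u : Fin U) (x : Fin U → ℂ) : ℂ :=
  (√(Pt / (4 * π * r₀ ^ 2)) : ℂ) * sphereIntegral (fun φ θ =>
    channel lam (X u) (element r₀ φ θ) *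
      (∑ k : Fin U, precoder lam r₀ (X k) (c k) φ θ * x k) * (r₀ : ℂ) ^ 2)

/-- Signal received by user `u` for the data symbols `x` and the noise sample `z`. -/
noncomputable def received {U M : ℕ} (lam Pt r₀ : ℝ) (X : Fin U → Space) (c : Fin U → Coeff M)
    (u : Fin U) (x : Fin U → ℂ) (z : ℂ) : ℂ :=
  ((lam / √(4 * π) : ℝ) : ℂ) * field lam Pt r₀ X c u x + z

/-- The circularly symmetric complex Gaussian law `CN(0, v)`: independent real and imaginary
parts of variance `v / 2`. -/
noncomputable def complexGaussian (v : ℝ) : Measure ℂ :=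
  ((ProbabilityTheory.gaussianReal 0 (v / 2).toNNReal).prod
    (ProbabilityTheory.gaussianReal 0 (v / 2).toNNReal)).map
      (fun p : ℝ × ℝ => (p.1 : ℂ) + (p.2 : ℂ) * I)

/-- Receive SNR of user `u`: expected power of the part of the received signal that carries the
user's own `CN(0, 1)` symbol, divided by the expected power of the `CN(0, σ²)` noise. -/
noncomputable def receiveSNR {U M : ℕ} (lam Pt σ r₀ : ℝ) (X : Fin U → Space)
    (c : Fin U → Coeff M) (u : Fin U) : ℝ :=
  (∫ s, ‖received lam Pt r₀ X c u (Pi.single u s) 0‖ ^ 2 ∂(complexGaussian 1)) /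
    (∫ z, ‖received lam Pt r₀ X c u 0 z‖ ^ 2 ∂(complexGaussian (σ ^ 2)))

/-! ### Zero forcing -/

/-- The coefficient `𝒥_{u,k,m,ℓ}` of a mode `(ℓ, m)`. Since `dir φ θ` is a unit vector, the inner
product `⟪X_u, dir φ θ⟫` is `r_u cos ψ_u`. -/
noncomputable def J {U M : ℕ} (lam : ℝ) (X : Fin U → Space) (u k : Fin U) (p : Mode M) : ℂ :=
  sphereIntegral (fun φ θ =>
    Complex.exp (I * ((2 * π / lam *
      (inner ℝ (X u) (dir φ θ) - inner ℝ (X k) (dir φ θ)) : ℝ) : ℂ)) * p.harm φ θ)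

/-- The matrix `𝒥̃_u`: rows indexed by the users `k ≠ u`, columns by the modes. -/
noncomputable def JMatrix {U : ℕ} (M : ℕ) (lam : ℝ) (X : Fin U → Space) (u : Fin U) :
    Matrix {k : Fin U // k ≠ u} (Mode M) ℂ :=
  Matrix.of fun k p => J lam X u k p

/-- The null space of `𝒥̃_u`. -/
noncomputable def nullSpace {U : ℕ} (M : ℕ) (lam : ℝ) (X : Fin U → Space) (u : Fin U) :
    Submodule ℂ (Coeff M) :=
  LinearMap.ker (Matrix.toEuclideanLin (JMatrix M lam X u))

/-- Admissible coefficients: each user's coefficient vector has energy at most `E`, and for every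
receiver `u` and every other user `k` the zero-forcing constraint
`∑_{ℓ,m} c_{k,m,ℓ} 𝒥_{u,k,m,ℓ} = 0` holds. -/
def Admissible {U M : ℕ} (lam E : ℝ) (X : Fin U → Space) (c : Fin U → Coeff M) : Prop :=
  (∀ k : Fin U, ∑ p : Mode M, ‖c k p‖ ^ 2 ≤ E) ∧
    ∀ u k : Fin U, k ≠ u → ∑ p : Mode M, c k p * J lam X u k p = 0

/-- The gain constant `η` for the coefficient energy `E`; it is `lam / (4 π)` for `E = 1`. -/
noncomputable def eta (lam E : ℝ) : ℝ := lam * √E / (4 * π)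

end SphUA

namespace SphUA

open scoped Real
open MeasureTheory Complex

/-! ### Integration over the sphere -/

/-! The channel times the user's own conjugate precoder is `|h_u|`: the phases cancel
(`channel_mul_conjPrecoder`). The SNR of user u is therefore κ |∑ c_p g_p|² with κ = λ²P_t/((4π)³σ²)
and gains g_p = ∫ (r₀/|X_u - A|) Y_p (`receiveSNR_eq`).

The constraints on c_u involve 𝒥_{k,u}, while the null space is built from 𝒥_{u,k}. The antipodal
map of the sphere exchanges the two up to the sign (-1)^ℓ (`J_swap`), so the isometric involution
`antipodalCoeff` carries the feasible c_u onto the ball of radius √E in the null space V. There the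
gain is ⟪W, v⟫ with W = `gainVector`, and the maximum is E times the squared norm of the projection
of W onto V (`isGreatest_norm_inner_sq`).

Since r₀/|X_u - A| = 1 + O(r_u/r₀) and only the constant harmonic has nonzero integral, W = √(4π) e₀
+ O(r_u/r₀). Projections are contractions, so the resulting error does not depend on V. -/

/-- The antipodal substitution in a spherical integral. -/
lemma sphereIntegral_antipode (F : ℝ → ℝ → ℂ) (hF : ∀ φ θ, F (φ + 2 * π) θ = F φ θ) :
    sphereIntegral (fun φ θ => F (φ + π) (π - θ)) = sphereIntegral F := by
  unfold sphereIntegral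
  have h1 : ∀ φ : ℝ, ∫ θ in (0 : ℝ)..π, F (φ + π) (π - θ) * (Real.sin θ : ℂ)
      = ∫ θ in (0 : ℝ)..π, F (φ + π) θ * (Real.sin θ : ℂ) := by
    intro φ
    have := intervalIntegral.integral_comp_sub_left (a := 0) (b := π)
      (fun θ => F (φ + π) θ * (Real.sin θ : ℂ)) π
    simpa only [Real.sin_pi_sub, sub_self, sub_zero] using this
  simp_rw [h1]
  rw [intervalIntegral.integral_comp_add_right
    (fun φ => ∫ θ in (0 : ℝ)..π, F φ θ * (Real.sin θ : ℂ)) π]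
  have hp : Function.Periodic (fun φ => ∫ θ in (0 : ℝ)..π, F φ θ * (Real.sin θ : ℂ)) (2 * π) := by
    intro φ
    simp only [hF]
  have := hp.intervalIntegral_add_eq π 0
  rw [zero_add] at this
  rw [zero_add, add_comm (2 * π), this]

lemma sphereIntegral_const_mul (a : ℂ) (F : ℝ → ℝ → ℂ) :
    sphereIntegral (fun φ θ => a * F φ θ) = a * sphereIntegral F := by
  simp only [sphereIntegral, mul_assoc, intervalIntegral.integral_const_mul]

lemma continuous_inner_sphereIntegral {F : ℝ → ℝ → ℂ} (hF : Continuous (Function.uncurry F)) :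
    Continuous (fun φ => ∫ θ in (0 : ℝ)..π, F φ θ * (Real.sin θ : ℂ)) := by
  apply intervalIntegral.continuous_parametric_intervalIntegral_of_continuous'
  exact hF.mul (by fun_prop)

lemma sphereIntegral_sum {ι : Type*} (s : Finset ι) (F : ι → ℝ → ℝ → ℂ)
    (hF : ∀ i ∈ s, Continuous (Function.uncurry (F i))) :
    sphereIntegral (fun φ θ => ∑ i ∈ s, F i φ θ) = ∑ i ∈ s, sphereIntegral (F i) := by
  unfold sphereIntegral
  rw [← intervalIntegral.integral_finsetSum
    fun i hi => (continuous_inner_sphereIntegral (hF i hi)).intervalIntegrable _ _]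
  congr 1
  ext φ
  rw [← intervalIntegral.integral_finsetSum]
  · simp only [Finset.sum_mul]
  · intro i hi
    apply Continuous.intervalIntegrable
    exact (Continuous.uncurry_left φ (hF i hi)).mul (by fun_prop)

lemma sphereIntegral_sub (F G : ℝ → ℝ → ℂ) (hF : Continuous (Function.uncurry F))
    (hG : Continuous (Function.uncurry G)) :
    sphereIntegral (fun φ θ => F φ θ - G φ θ) = sphereIntegral F - sphereIntegral G := by
  unfold sphereIntegral
  rw [← intervalIntegral.integral_sub
    ((continuous_inner_sphereIntegral hF).intervalIntegrable _ _)
    ((continuous_inner_sphereIntegral hG).intervalIntegrable _ _)]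
  congr 1
  ext φ
  rw [← intervalIntegral.integral_sub]
  · simp only [sub_mul]
  · exact ((Continuous.uncurry_left φ hF).mul (by fun_prop)).intervalIntegrable _ _
  · exact ((Continuous.uncurry_left φ hG).mul (by fun_prop)).intervalIntegrable _ _

lemma norm_sphereIntegral_le {F : ℝ → ℝ → ℂ} {B : ℝ}
    (hB : ∀ φ ∈ Set.Icc 0 (2 * π), ∀ θ ∈ Set.Icc 0 π, ‖F φ θ‖ ≤ B) :
    ‖sphereIntegral F‖ ≤ B * π * (2 * π) := by
  have hpi := Real.pi_pos
  have h : ‖sphereIntegral F‖ ≤ B * π * |2 * π - 0| := by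
    apply intervalIntegral.norm_integral_le_of_norm_le_const
    intro φ hφ
    rw [Set.uIoc_of_le (by positivity)] at hφ
    have h2 : ‖∫ θ in (0 : ℝ)..π, F φ θ * (Real.sin θ : ℂ)‖ ≤ B * |π - 0| := by
      apply intervalIntegral.norm_integral_le_of_norm_le_const
      intro θ hθ
      rw [Set.uIoc_of_le hpi.le] at hθ
      have := hB φ ⟨hφ.1.le, hφ.2⟩ θ ⟨hθ.1.le, hθ.2⟩
      rw [norm_mul, Complex.norm_real, Real.norm_eq_abs]
      exact (mul_le_of_le_one_right (norm_nonneg _) (Real.abs_sin_le_one θ)).trans this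
    rwa [sub_zero, abs_of_pos hpi] at h2
  rwa [sub_zero, abs_of_pos (by positivity)] at h

/-! ### Spherical harmonics -/

lemma Mode.neg_le_order {M : ℕ} (p : Mode M) : -((p.1 : ℕ) : ℤ) ≤ p.order := by
  unfold Mode.order; omega

lemma Mode.order_le {M : ℕ} (p : Mode M) : p.order ≤ ((p.1 : ℕ) : ℤ) := by
  have := p.2.2
  unfold Mode.order; omega

lemma Mode.eq_zero {M : ℕ} {p : Mode M} (h1 : (p.1 : ℕ) = 0) : p = Mode.zero M := by
  obtain ⟨⟨l, hl⟩, i, hi⟩ := p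
  simp only at h1
  subst h1
  have : i = 0 := by simp at hi; exact hi
  subst this
  rfl

/-- The parity of an iterated derivative of a polynomial of known parity. -/
lemma eval_neg_iterate_derivative {R : Type*} [CommRing R] (q : Polynomial R)
    (hq : q.comp (-Polynomial.X) = q) (n : ℕ) (x : R) :
    (Polynomial.derivative^[n] q).eval (-x) = (-1) ^ n * (Polynomial.derivative^[n] q).eval x := by
  have h : ∀ n, (Polynomial.derivative^[n] q).comp (-Polynomial.X)
      = (-1) ^ n * Polynomial.derivative^[n] q := by
    intro n
    induction n with
    | zero => simpa using hq
    | succ k ih =>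
      have h2 := congrArg Polynomial.derivative ih
      rw [Polynomial.derivative_comp] at h2
      have h3 : ((-1 : Polynomial R)) ^ k = Polynomial.C ((-1) ^ k) := by simp
      rw [h3, Polynomial.derivative_C_mul, ← h3] at h2
      simp only [Polynomial.derivative_neg, Polynomial.derivative_X] at h2
      rw [Function.iterate_succ_apply', pow_succ]
      linear_combination -h2
  have := congrArg (Polynomial.eval x) (h n)
  simpa [Polynomial.eval_comp] using this

/-- The polynomial (x² - 1)^ℓ is even and each of the m + ℓ derivatives flips the parity. The bound
on m makes `toNat` exact. -/
lemma assocLegendre_neg {ℓ : ℕ} {m : ℤ} (h : -(ℓ : ℤ) ≤ m) (x : ℝ) :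
    assocLegendre ℓ m (-x) = (-1) ^ (m + ℓ) * assocLegendre ℓ m x := by
  unfold assocLegendre
  rw [eval_neg_iterate_derivative _ (by simp)]
  have : ((-1 : ℝ)) ^ (m + ℓ) = (-1) ^ (m + ℓ).toNat := by
    rw [← zpow_natCast, Int.toNat_of_nonneg (by omega)]
  rw [this, neg_sq]
  ring

/-- The Legendre factor contributes (-1)^(m+ℓ) and the azimuthal shift (-1)^m. -/
lemma sphHarm_antipode {ℓ : ℕ} {m : ℤ} (h : -(ℓ : ℤ) ≤ m) (φ θ : ℝ) :
    sphHarm ℓ m (φ + π) (π - θ) = (-1) ^ ℓ * sphHarm ℓ m φ θ := by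
  unfold sphHarm
  have hexp : Complex.exp (I * ((m : ℂ) * ((φ + π : ℝ) : ℂ)))
      = (-1) ^ m * Complex.exp (I * ((m : ℂ) * (φ : ℂ))) := by
    rw [← Complex.exp_pi_mul_I, ← Complex.exp_int_mul, ← Complex.exp_add]
    congr 1
    push_cast
    ring
  rw [hexp, Real.cos_pi_sub, assocLegendre_neg h]
  have h2 : ((-1 : ℂ)) ^ (m + ℓ) * (-1) ^ m = (-1) ^ ℓ := by
    rw [zpow_add₀ (by simp), zpow_natCast, mul_right_comm, ← mul_zpow]
    simp
  rw [← h2]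
  push_cast
  ring

lemma sphHarm_add_two_pi (ℓ : ℕ) (m : ℤ) (φ θ : ℝ) :
    sphHarm ℓ m (φ + 2 * π) θ = sphHarm ℓ m φ θ := by
  unfold sphHarm
  congr 1
  rw [Complex.exp_eq_exp_iff_exists_int]
  exact ⟨m, by push_cast; ring⟩

/-- For m = -n < 0 the power (1 - x²)^(m/2) is singular at the poles, but only ℓ - n derivatives are
taken, so a factor (x² - 1)^n survives and the total exponent is n/2 > 0. -/
lemma continuous_assocLegendre_cos {ℓ : ℕ} {m : ℤ} (h : -(ℓ : ℤ) ≤ m) :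
    Continuous (fun θ => assocLegendre ℓ m (Real.cos θ)) := by
  rcases le_or_gt 0 m with hm | hm
  · unfold assocLegendre
    refine Continuous.mul (Continuous.mul continuous_const ?_) ?_
    · refine Continuous.rpow_const (by fun_prop) fun _ => Or.inr ?_
      have : (0 : ℝ) ≤ m := by exact_mod_cast hm
      positivity
    · exact (Polynomial.continuous _).comp Real.continuous_cos
  · obtain ⟨n, hn⟩ : ∃ n : ℕ, m = -(n : ℤ) := ⟨m.natAbs, by omega⟩
    have hnl : n ≤ ℓ := by omega
    have hn0 : 0 < n := by omega
    obtain ⟨R, hR⟩ := Polynomial.pow_sub_dvd_iterate_derivative_of_pow_dvd (ℓ - n)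
      (dvd_refl (((Polynomial.X : Polynomial ℝ) ^ 2 - 1) ^ ℓ))
    have hnn : ℓ - (ℓ - n) = n := by omega
    have key : (fun θ => assocLegendre ℓ m (Real.cos θ)) = fun θ =>
        (-1 : ℝ) ^ m / (2 ^ ℓ * (ℓ.factorial : ℝ)) * ((-1) ^ n *
          (1 - Real.cos θ ^ 2) ^ ((n : ℝ) / 2) * R.eval (Real.cos θ)) := by
      ext θ
      unfold assocLegendre
      have h1 : (m + ℓ).toNat = ℓ - n := by omega
      rw [h1, hR, hnn]
      have hy : (0 : ℝ) ≤ 1 - Real.cos θ ^ 2 := by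
        have := Real.cos_sq_le_one θ
        linarith
      have h2 : (1 - Real.cos θ ^ 2) ^ ((n : ℝ) / 2)
          = (1 - Real.cos θ ^ 2) ^ ((m : ℝ) / 2) * (1 - Real.cos θ ^ 2) ^ n := by
        have hn' : (n : ℝ) ≠ 0 := by positivity
        -- The base vanishes at the poles; exponents still add there because their sum n/2 is
        -- nonzero.
        rw [← Real.rpow_natCast _ n, ← Real.rpow_add' hy]
        · congr 1
          rw [hn]; push_cast; ring
        · rw [hn]; push_cast
          intro hc; apply hn'; linarith
      have h3 : (Real.cos θ ^ 2 - 1) ^ n = (-1) ^ n * (1 - Real.cos θ ^ 2) ^ n := by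
        rw [← mul_pow]; congr 1; ring
      rw [h2]
      simp only [Polynomial.eval_mul, Polynomial.eval_pow, Polynomial.eval_sub,
        Polynomial.eval_X, Polynomial.eval_one]
      rw [h3]
      ring
    rw [key]
    refine Continuous.mul continuous_const (Continuous.mul (Continuous.mul continuous_const ?_) ?_)
    · exact Continuous.rpow_const (by fun_prop) fun _ => Or.inr (by positivity)
    · exact (Polynomial.continuous _).comp Real.continuous_cos

lemma continuous_sphHarm {ℓ : ℕ} {m : ℤ} (h : -(ℓ : ℤ) ≤ m) :
    Continuous (Function.uncurry (sphHarm ℓ m)) := by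
  have h1 := (continuous_assocLegendre_cos h).comp (continuous_snd (X := ℝ) (Y := ℝ))
  have : Function.uncurry (sphHarm ℓ m) = fun q : ℝ × ℝ => sphHarm ℓ m q.1 q.2 := rfl
  rw [this]
  unfold sphHarm
  refine Continuous.mul (Complex.continuous_ofReal.comp (Continuous.mul continuous_const h1)) ?_
  fun_prop

lemma Mode.continuous_harm {M : ℕ} (p : Mode M) : Continuous (Function.uncurry p.harm) :=
  continuous_sphHarm p.neg_le_order

lemma sphereIntegral_sphHarm_of_order_ne_zero {ℓ : ℕ} {m : ℤ} (hm : m ≠ 0) :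
    sphereIntegral (sphHarm ℓ m) = 0 := by
  unfold sphereIntegral sphHarm
  simp_rw [mul_right_comm _ (Complex.exp _), intervalIntegral.integral_mul_const]
  rw [intervalIntegral.integral_const_mul]
  have h2 : ∀ φ : ℝ, I * ((m : ℂ) * (φ : ℂ)) = (I * m) * φ := fun φ => by ring
  simp_rw [h2]
  rw [integral_exp_mul_complex (by simp [hm])]
  have : Complex.exp (I * m * ((2 * π : ℝ) : ℂ)) = 1 := by
    rw [Complex.exp_eq_one_iff]
    exact ⟨m, by push_cast; ring⟩
  rw [this]
  simp

lemma assocLegendre_zero_order (ℓ : ℕ) (x : ℝ) : assocLegendre ℓ 0 x =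
    1 / (2 ^ ℓ * (ℓ.factorial : ℝ)) * (Polynomial.derivative^[ℓ]
      (((Polynomial.X : Polynomial ℝ) ^ 2 - 1) ^ ℓ)).eval x := by
  simp [assocLegendre]

lemma sphereIntegral_sphHarm_order_zero {ℓ : ℕ} (hℓ : ℓ ≠ 0) :
    sphereIntegral (sphHarm ℓ 0) = 0 := by
  have hreal : ∫ θ in (0 : ℝ)..π, assocLegendre ℓ 0 (Real.cos θ) * Real.sin θ = 0 := by
    obtain ⟨k, rfl⟩ := Nat.exists_eq_succ_of_ne_zero hℓ
    simp_rw [assocLegendre_zero_order, mul_assoc]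
    rw [intervalIntegral.integral_const_mul, mul_eq_zero]
    right
    set Q := Polynomial.derivative^[k] (((Polynomial.X : Polynomial ℝ) ^ 2 - 1) ^ (k + 1)) with hQ
    have hd : ∀ θ ∈ Set.uIcc (0 : ℝ) π, HasDerivAt (fun θ => -Q.eval (Real.cos θ))
        ((Polynomial.derivative^[k.succ]
          (((Polynomial.X : Polynomial ℝ) ^ 2 - 1) ^ k.succ)).eval (Real.cos θ) * Real.sin θ) θ := by
      intro θ _
      have := ((Q.hasDerivAt (Real.cos θ)).comp θ (Real.hasDerivAt_cos θ)).neg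
      have hval : -(Polynomial.eval (Real.cos θ) (Polynomial.derivative Q) * -Real.sin θ) =
          (Polynomial.derivative^[k.succ]
            (((Polynomial.X : Polynomial ℝ) ^ 2 - 1) ^ k.succ)).eval (Real.cos θ) *
              Real.sin θ := by
        rw [hQ, Function.iterate_succ_apply']
        ring
      rw [hval] at this
      exact this
    rw [intervalIntegral.integral_eq_sub_of_hasDerivAt hd]
    -- One derivative fewer than the full order leaves a factor x² - 1, so the antiderivative
    -- vanishes at both endpoints x = ±1.
    · obtain ⟨R, hR⟩ := Polynomial.pow_sub_dvd_iterate_derivative_of_pow_dvd k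
        (dvd_refl (((Polynomial.X : Polynomial ℝ) ^ 2 - 1) ^ (k + 1)))
      rw [← hQ, Nat.add_sub_cancel_left, pow_one] at hR
      rw [hR]
      simp
    · apply Continuous.intervalIntegrable
      exact ((Polynomial.continuous _).comp Real.continuous_cos).mul Real.continuous_sin
  unfold sphereIntegral sphHarm
  simp only [Int.cast_zero, zero_mul, mul_zero, Complex.exp_zero, mul_one, ← Complex.ofReal_mul]
  simp_rw [intervalIntegral.integral_ofReal, mul_assoc, intervalIntegral.integral_const_mul, hreal]
  simp

lemma sphereIntegral_sphHarm_zero : sphereIntegral (sphHarm 0 0) = (√(4 * π) : ℂ) := by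
  have h1 : ∀ φ θ : ℝ, sphHarm 0 0 φ θ = ((√(1 / (4 * π)) : ℝ) : ℂ) := by
    intro φ θ
    simp [sphHarm, assocLegendre]
  unfold sphereIntegral
  simp_rw [h1, ← Complex.ofReal_mul, intervalIntegral.integral_ofReal,
    intervalIntegral.integral_const_mul, integral_sin, intervalIntegral.integral_const]
  have hpi := Real.pi_pos
  rw [Real.sqrt_div zero_le_one, Real.sqrt_one]
  have h2 : √(4 * π) * √(4 * π) = 4 * π := Real.mul_self_sqrt (by positivity)
  have h3 : √(4 * π) ≠ 0 := by positivity
  congr 1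
  simp only [Real.cos_zero, Real.cos_pi, smul_eq_mul]
  field_simp
  nlinarith

/-- Orders m ≠ 0 vanish in the azimuthal integral, and m = 0 with ℓ > 0 by Rodrigues' formula. -/
lemma Mode.sphereIntegral_harm {M : ℕ} (p : Mode M) :
    sphereIntegral p.harm = if p = Mode.zero M then (√(4 * π) : ℂ) else 0 := by
  split_ifs with h
  · subst h
    exact sphereIntegral_sphHarm_zero
  · have h1 : (p.1 : ℕ) ≠ 0 := fun h1 => h (Mode.eq_zero h1)
    change sphereIntegral (sphHarm (p.1 : ℕ) p.order) = 0
    by_cases hm : p.order = 0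
    · rw [hm]
      exact sphereIntegral_sphHarm_order_zero h1
    · exact sphereIntegral_sphHarm_of_order_ne_zero hm

/-! ### Symmetry of the zero-forcing coefficients -/

lemma dir_antipode (φ θ : ℝ) : dir (φ + π) (π - θ) = -dir φ θ := by
  ext i
  fin_cases i <;> simp [dir, Real.cos_add_pi, Real.sin_add_pi]

lemma norm_dir (φ θ : ℝ) : ‖dir φ θ‖ = 1 := by
  rw [EuclideanSpace.norm_eq, Real.sqrt_eq_one]
  simp only [Fin.sum_univ_three, dir, Real.norm_eq_abs, sq_abs]
  simp
  nlinarith [Real.sin_sq_add_cos_sq φ, Real.sin_sq_add_cos_sq θ]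

lemma continuous_dir : Continuous (Function.uncurry dir) := by
  unfold dir Function.uncurry
  apply (PiLp.continuous_toLp 2 _).comp
  refine continuous_pi fun i => ?_
  fin_cases i <;> simp <;> fun_prop

/-- Negating the direction exchanges u and k in the phase, while the harmonic picks up (-1)^ℓ. -/
lemma J_swap {U M : ℕ} (lam : ℝ) (X : Fin U → Space) (u k : Fin U) (p : Mode M) :
    J lam X k u p = (-1) ^ (p.1 : ℕ) * J lam X u k p := by
  unfold J
  rw [← sphereIntegral_antipode, ← sphereIntegral_const_mul]
  · congr 1
    ext φ θ
    rw [dir_antipode]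
    simp only [Mode.harm, sphHarm_antipode p.neg_le_order, inner_neg_right]
    rw [mul_left_comm]
    congr 4
    push_cast
    ring
  · intro φ θ
    simp only [Mode.harm, sphHarm_add_two_pi, dir, Real.cos_add_two_pi, Real.sin_add_two_pi]

/-! ### Second moment of the complex Gaussian law -/

lemma integral_sq_gaussianReal (v : NNReal) :
    ∫ x, x ^ 2 ∂(ProbabilityTheory.gaussianReal 0 v) = v := by
  have h := ProbabilityTheory.variance_fun_id_gaussianReal (μ := 0) (v := v)
  rwa [ProbabilityTheory.variance_of_integral_eq_zero (by fun_prop)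
    ProbabilityTheory.integral_id_gaussianReal] at h

lemma integral_norm_sq_complexGaussian {v : ℝ} (hv : 0 ≤ v) :
    ∫ z, ‖z‖ ^ 2 ∂(complexGaussian v) = v := by
  unfold complexGaussian
  rw [integral_map (by fun_prop) (by fun_prop)]
  have h : ∀ p : ℝ × ℝ, ‖(p.1 : ℂ) + (p.2 : ℂ) * I‖ ^ 2 = p.1 ^ 2 + p.2 ^ 2 := by
    intro p
    rw [Complex.sq_norm, Complex.normSq_add_mul_I]
  have hi : Integrable (fun x : ℝ => x ^ 2)
      (ProbabilityTheory.gaussianReal 0 (v / 2).toNNReal) :=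
    (ProbabilityTheory.memLp_id_gaussianReal 2).integrable_sq
  simp_rw [h]
  rw [integral_add (hi.comp_fst _) (hi.comp_snd _), integral_fun_fst (fun x : ℝ => x ^ 2),
    integral_fun_snd (fun x : ℝ => x ^ 2), integral_sq_gaussianReal]
  simp only [probReal_univ, one_smul]
  rw [Real.coe_toNNReal _ (by positivity)]
  ring

/-! ### Maximizing a linear functional over a ball of a subspace -/

/-- Against vectors of V, W may be replaced by its projection; Parseval in V then applies. -/
lemma sum_norm_inner_sq_eq {F : Type*} [NormedAddCommGroup F] [InnerProductSpace ℂ F]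
    (V : Submodule ℂ F) [FiniteDimensional ℂ V] {ι : Type*} [Fintype ι]
    (b : OrthonormalBasis ι ℂ V) (W : F) :
    ∑ i, ‖inner ℂ W (b i : F)‖ ^ 2 = ‖V.orthogonalProjectionOnto W‖ ^ 2 := by
  simp_rw [← Submodule.inner_orthogonalProjectionOnto_eq_of_mem_right]
  exact b.sum_sq_norm_inner_left _

lemma isGreatest_norm_inner_sq {F : Type*} [NormedAddCommGroup F] [InnerProductSpace ℂ F]
    (V : Submodule ℂ F) [FiniteDimensional ℂ V] {ι : Type*} [Fintype ι]
    (b : OrthonormalBasis ι ℂ V) (W : F) {E : ℝ} (hE : 0 ≤ E) :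
    IsGreatest {s : ℝ | ∃ v ∈ V, ‖v‖ ^ 2 ≤ E ∧ s = ‖inner ℂ W v‖ ^ 2}
      (E * ∑ i, ‖inner ℂ W (b i : F)‖ ^ 2) := by
  rw [sum_norm_inner_sq_eq]
  set P := V.orthogonalProjectionOnto W
  have h : ∀ v : V, inner ℂ W (v : F) = inner ℂ P v :=
    fun v => (Submodule.inner_orthogonalProjectionOnto_eq_of_mem_right v W).symm
  constructor
  -- Equality in Cauchy–Schwarz: the projection rescaled to norm √E. If it is zero, division by zero
  -- gives v = 0, and the maximum is 0.
  · refine ⟨(((√E / ‖P‖ : ℝ) : ℂ) • P : V), Submodule.coe_mem _, ?_, ?_⟩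
    · rw [← Submodule.coe_norm, norm_smul, Complex.norm_real, Real.norm_eq_abs, abs_div, abs_norm,
        abs_of_nonneg (Real.sqrt_nonneg E)]
      by_cases hz : ‖P‖ = 0
      · simpa [hz] using hE
      · rw [div_mul_cancel₀ _ hz, Real.sq_sqrt hE]
    · rw [h, inner_smul_right, inner_self_eq_norm_sq_to_K, norm_mul, Complex.norm_real,
        Real.norm_eq_abs, abs_div, abs_norm, abs_of_nonneg (Real.sqrt_nonneg E)]
      simp only [Complex.coe_algebraMap, norm_pow, Complex.norm_real, norm_norm]
      by_cases hz : ‖P‖ = 0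
      · simp [hz]
      · rw [mul_pow, div_pow, Real.sq_sqrt hE]
        field_simp
  · rintro s ⟨v, hv, hvE, rfl⟩
    rw [h ⟨v, hv⟩]
    calc ‖inner ℂ P (⟨v, hv⟩ : V)‖ ^ 2 ≤ (‖P‖ * ‖v‖) ^ 2 := by
          gcongr
          exact norm_inner_le_norm _ _
      _ = ‖v‖ ^ 2 * ‖P‖ ^ 2 := by ring
      _ ≤ E * ‖P‖ ^ 2 := by gcongr

/-- A difference of squares of projection norms, bounded by contractivity. The right side is free of
V, which makes the final constant independent of the users. -/
lemma abs_sum_norm_inner_sq_sub_le {F : Type*} [NormedAddCommGroup F] [InnerProductSpace ℂ F]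
    (V : Submodule ℂ F) [FiniteDimensional ℂ V] {ι : Type*} [Fintype ι]
    (b : OrthonormalBasis ι ℂ V) (W W' : F) :
    |∑ i, ‖inner ℂ W (b i : F)‖ ^ 2 - ∑ i, ‖inner ℂ W' (b i : F)‖ ^ 2| ≤
      ‖W - W'‖ * (‖W‖ + ‖W'‖) := by
  simp only [sum_norm_inner_sq_eq]
  have hP : ∀ Z, ‖V.orthogonalProjectionOnto Z‖ ≤ ‖Z‖ :=
    Submodule.norm_orthogonalProjectionOnto_apply_le V
  have hsub := abs_norm_sub_norm_le (V.orthogonalProjectionOnto W) (V.orthogonalProjectionOnto W')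
  rw [← map_sub] at hsub
  rw [sq_sub_sq, abs_mul, mul_comm, abs_of_nonneg (a := _ + _) (by positivity)]
  exact mul_le_mul (hsub.trans (hP _)) (add_le_add (hP W) (hP W')) (by positivity) (norm_nonneg _)

/-! ### Zero forcing as membership in the null space -/

lemma mem_nullSpace_iff {U M : ℕ} (lam : ℝ) (X : Fin U → Space) (u : Fin U) (v : Coeff M) :
    v ∈ nullSpace M lam X u ↔ ∀ k, k ≠ u → ∑ p : Mode M, v p * J lam X u k p = 0 := by
  unfold nullSpace JMatrix
  rw [LinearMap.mem_ker, Matrix.toLpLin_apply, WithLp.toLp_eq_zero, funext_iff]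
  simp only [Matrix.mulVec, dotProduct, Matrix.of_apply, Pi.zero_apply, Subtype.forall, mul_comm]

/-- The action of the antipodal map on mode coefficients: multiplication by `(-1)^ℓ`. -/
noncomputable def antipodalCoeff {M : ℕ} (c : Coeff M) : Coeff M :=
  WithLp.toLp 2 fun p => (-1) ^ (p.1 : ℕ) * c p

lemma antipodalCoeff_apply {M : ℕ} (c : Coeff M) (p : Mode M) :
    antipodalCoeff c p = (-1) ^ (p.1 : ℕ) * c p := rfl

lemma antipodalCoeff_antipodalCoeff {M : ℕ} (c : Coeff M) :
    antipodalCoeff (antipodalCoeff c) = c := by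
  ext p
  rw [antipodalCoeff_apply, antipodalCoeff_apply, ← mul_assoc, ← mul_pow]
  simp

lemma norm_antipodalCoeff_sq {M : ℕ} (c : Coeff M) :
    ‖antipodalCoeff c‖ ^ 2 = ∑ p, ‖c p‖ ^ 2 := by
  simp [EuclideanSpace.norm_sq_eq, antipodalCoeff_apply]

lemma antipodalCoeff_mem_nullSpace_iff {U M : ℕ} (lam : ℝ) (X : Fin U → Space) (u : Fin U)
    (c : Coeff M) : antipodalCoeff c ∈ nullSpace M lam X u ↔
      ∀ k, k ≠ u → ∑ p : Mode M, c p * J lam X k u p = 0 := by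
  rw [mem_nullSpace_iff]
  refine forall_congr' fun k => imp_congr_right fun _ => ?_
  simp_rw [J_swap lam X u k, antipodalCoeff_apply, mul_left_comm, mul_assoc]

/-- Any coefficient vector that satisfies the constraints of one user extends to an admissible
family. -/
lemma exists_admissible_iff {U M : ℕ} {lam E : ℝ} (hE : 0 ≤ E) (X : Fin U → Space) (u : Fin U)
    (c : Coeff M) : (∃ d : Fin U → Coeff M, Admissible lam E X d ∧ d u = c) ↔
      antipodalCoeff c ∈ nullSpace M lam X u ∧ ‖antipodalCoeff c‖ ^ 2 ≤ E := by
  rw [antipodalCoeff_mem_nullSpace_iff, norm_antipodalCoeff_sq]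
  constructor
  · rintro ⟨d, hd, rfl⟩
    exact ⟨fun k hk => hd.2 k u hk.symm, hd.1 u⟩
  · rintro ⟨h1, h2⟩
    -- Each constraint involves a single user's coefficients, so all other users can be given zero.
    refine ⟨Pi.single u c, ⟨fun k => ?_, fun j k hkj => ?_⟩, by simp⟩
    · rcases eq_or_ne k u with rfl | hk
      · simpa using h2
      · simpa [hk] using hE
    · rcases eq_or_ne k u with rfl | hk
      · simpa using h1 j hkj.symm
      · simp [hk]

/-! ### The received signal -/

/-- Array radius over the distance between a user and an array element. -/
noncomputable def pathRatio (r₀ : ℝ) (x : Space) (φ θ : ℝ) : ℝ :=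
  r₀ / dist x (element r₀ φ θ)

/-- Gain of a phase mode at the user it is precoded for, up to a common factor. -/
noncomputable def modeGain {M : ℕ} (r₀ : ℝ) (x : Space) (p : Mode M) : ℂ :=
  sphereIntegral fun φ θ => (pathRatio r₀ x φ θ : ℂ) * p.harm φ θ

lemma norm_element {r₀ : ℝ} (hr : 0 < r₀) (φ θ : ℝ) : ‖element r₀ φ θ‖ = r₀ := by
  rw [element, norm_smul, norm_dir, mul_one, Real.norm_of_nonneg hr.le]

lemma half_le_dist_element {r₀ : ℝ} (hr : 0 < r₀) {x : Space} (hx : 2 * ‖x‖ ≤ r₀) (φ θ : ℝ) :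
    r₀ / 2 ≤ dist x (element r₀ φ θ) := by
  have h := norm_sub_norm_le (element r₀ φ θ) x
  rw [norm_element hr, ← dist_eq_norm, dist_comm] at h
  linarith

/-- The reverse triangle inequality gives |r₀ - dist| ≤ ‖x‖; the factor 2 comes from dist ≥ r₀/2. -/
lemma abs_pathRatio_sub_one_le {r₀ : ℝ} (hr : 0 < r₀) {x : Space} (hx : 2 * ‖x‖ ≤ r₀)
    (φ θ : ℝ) : |pathRatio r₀ x φ θ - 1| ≤ 2 * (‖x‖ / r₀) := by
  have hd := half_le_dist_element hr hx φ θ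
  have hd0 : 0 < dist x (element r₀ φ θ) := by linarith
  have h := abs_norm_sub_norm_le (element r₀ φ θ) (element r₀ φ θ - x)
  rw [norm_element hr, ← dist_eq_norm, dist_comm, sub_sub_cancel] at h
  rw [pathRatio, div_sub_one hd0.ne', abs_div, abs_of_pos hd0, div_le_iff₀ hd0]
  refine h.trans ?_
  calc ‖x‖ = 2 * (‖x‖ / r₀) * (r₀ / 2) := by field_simp
    _ ≤ _ := by gcongr

lemma continuous_pathRatio {r₀ : ℝ} (hr : 0 < r₀) {x : Space} (hx : 2 * ‖x‖ ≤ r₀) :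
    Continuous (Function.uncurry (pathRatio r₀ x)) := by
  refine Continuous.div continuous_const ?_ fun q => ?_
  · exact continuous_const.dist (continuous_dir.const_smul r₀)
  · have := half_le_dist_element hr hx q.1 q.2
    linarith

lemma continuous_pathRatio_mul_harm {M : ℕ} {r₀ : ℝ} (hr : 0 < r₀) {x : Space}
    (hx : 2 * ‖x‖ ≤ r₀) (p : Mode M) :
    Continuous (Function.uncurry fun φ θ => (pathRatio r₀ x φ θ : ℂ) * p.harm φ θ) :=
  (Complex.continuous_ofReal.comp (continuous_pathRatio hr hx)).mul p.continuous_harm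

lemma channel_mul_conjPrecoder (lam : ℝ) {r₀ : ℝ} (hr : 0 < r₀) (x : Space) (φ θ : ℝ) :
    channel lam x (element r₀ φ θ) * conjPrecoder lam r₀ x φ θ =
      ((pathRatio r₀ x φ θ / (√(4 * π) * r₀) : ℝ) : ℂ) := by
  have hn : ‖channel lam x (element r₀ φ θ)‖ = pathRatio r₀ x φ θ / (√(4 * π) * r₀) := by
    have he : ∀ t : ℝ, ‖Complex.exp (-I * (t : ℂ))‖ = 1 := by
      intro t
      rw [Complex.norm_exp]
      simp
    rw [channel, norm_mul, he, mul_one, Complex.norm_real, Real.norm_of_nonneg (by positivity),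
      pathRatio]
    field_simp
  rw [conjPrecoder, mul_div_assoc', Complex.mul_conj, Complex.normSq_eq_norm_sq, ← hn]
  push_cast
  rw [sq, mul_self_div_self]

lemma received_single {U M : ℕ} (lam Pt : ℝ) {r₀ : ℝ} (hr : 0 < r₀) (X : Fin U → Space)
    (c : Fin U → Coeff M) (u : Fin U) (hX : 2 * ‖X u‖ ≤ r₀) (s : ℂ) :
    received lam Pt r₀ X c u (Pi.single u s) 0 =
      ((lam / √(4 * π) * √(Pt / (4 * π * r₀ ^ 2)) * (r₀ / √(4 * π)) : ℝ) : ℂ) *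
        (∑ p : Mode M, c u p * modeGain r₀ (X u) p) * s := by
  have hint : sphereIntegral (fun φ θ => channel lam (X u) (element r₀ φ θ) *
      (∑ k : Fin U, precoder lam r₀ (X k) (c k) φ θ * (Pi.single u s : Fin U → ℂ) k) *
        (r₀ : ℂ) ^ 2) =
      ((r₀ / √(4 * π) : ℝ) : ℂ) * s * ∑ p : Mode M, c u p * modeGain r₀ (X u) p := by
    have h1 : ∀ φ θ, channel lam (X u) (element r₀ φ θ) *
        (∑ k : Fin U, precoder lam r₀ (X k) (c k) φ θ * (Pi.single u s : Fin U → ℂ) k) *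
          (r₀ : ℂ) ^ 2 = (((r₀ / √(4 * π) : ℝ) : ℂ) * s) *
            ∑ p : Mode M, c u p * ((pathRatio r₀ (X u) φ θ : ℂ) * p.harm φ θ) := by
      intro φ θ
      rw [Fintype.sum_eq_single u (fun k hk => by simp [hk]), Pi.single_eq_same, precoder]
      simp_rw [mul_left_comm (c u _), ← Finset.mul_sum]
      have h2 := channel_mul_conjPrecoder lam hr (X u) φ θ
      have h3 : ((r₀ / √(4 * π) : ℝ) : ℂ) * (pathRatio r₀ (X u) φ θ : ℂ) =
          ((pathRatio r₀ (X u) φ θ / (√(4 * π) * r₀) : ℝ) : ℂ) * (r₀ : ℂ) ^ 2 := by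
        norm_cast
        field_simp
      linear_combination (∑ p : Mode M, c u p * p.harm φ θ) * s * (r₀ : ℂ) ^ 2 * h2 -
        (∑ p : Mode M, c u p * p.harm φ θ) * s * h3
    simp_rw [h1]
    rw [sphereIntegral_const_mul, sphereIntegral_sum]
    · simp_rw [sphereIntegral_const_mul]
      rfl
    · intro p _
      exact continuous_const.mul (continuous_pathRatio_mul_harm hr hX p)
  rw [received, field, hint]
  push_cast
  ring

/-- The receive SNR depends on the user's own coefficients through one linear functional. -/
lemma receiveSNR_eq {U M : ℕ} {lam Pt σ r₀ : ℝ} (hPt : 0 < Pt) (hr : 0 < r₀)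
    (X : Fin U → Space) (c : Fin U → Coeff M) (u : Fin U) (hX : 2 * ‖X u‖ ≤ r₀) :
    receiveSNR lam Pt σ r₀ X c u = lam ^ 2 * Pt / ((4 * π) ^ 3 * σ ^ 2) *
      ‖∑ p : Mode M, c u p * modeGain r₀ (X u) p‖ ^ 2 := by
  have hpi := Real.pi_pos
  have h0 : ∀ z, received lam Pt r₀ X c u 0 z = z := by
    intro z
    simp [received, field, sphereIntegral]
  unfold receiveSNR
  simp_rw [h0, received_single lam Pt hr X c u hX, norm_mul _ (_ : ℂ), mul_pow]
  rw [integral_const_mul, integral_norm_sq_complexGaussian zero_le_one,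
    integral_norm_sq_complexGaussian (sq_nonneg σ), Complex.norm_real, Real.norm_eq_abs, sq_abs]
  have h1 : √(4 * π) ^ 2 = 4 * π := Real.sq_sqrt (by positivity)
  have h2 : √(Pt / (4 * π * r₀ ^ 2)) ^ 2 = Pt / (4 * π * r₀ ^ 2) := Real.sq_sqrt (by positivity)
  -- The r₀² from the surface integral cancels the r₀² of the array area.
  rw [mul_pow, mul_pow, div_pow, div_pow, h1, h2]
  field_simp

/-! ### The gain vector and its far-field limit -/

/-- The vector representing the gain functional after the antipodal map. -/
noncomputable def gainVector (M : ℕ) (r₀ : ℝ) (x : Space) : Coeff M :=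
  WithLp.toLp 2 fun p => (-1) ^ (p.1 : ℕ) * (starRingEnd ℂ) (modeGain r₀ x p)

/-- The two signs (-1)^ℓ cancel, and the conjugation compensates for conjugate-linearity in the
first slot. -/
lemma inner_gainVector_antipodalCoeff {M : ℕ} (r₀ : ℝ) (x : Space) (c : Coeff M) :
    inner ℂ (gainVector M r₀ x) (antipodalCoeff c) = ∑ p, c p * modeGain r₀ x p := by
  rw [PiLp.inner_apply]
  refine Finset.sum_congr rfl fun p _ => ?_
  have h : ((-1 : ℂ) ^ (p.1 : ℕ)) * (-1) ^ (p.1 : ℕ) = 1 := by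
    rw [← mul_pow]; simp
  simp only [gainVector, antipodalCoeff_apply, RCLike.inner_apply, map_mul, map_pow, map_neg,
    map_one, Complex.conj_conj]
  linear_combination c p * modeGain r₀ x p * h

lemma exists_norm_harm_le {M : ℕ} (p : Mode M) :
    ∃ B : ℝ, ∀ φ ∈ Set.Icc 0 (2 * π), ∀ θ ∈ Set.Icc 0 π, ‖p.harm φ θ‖ ≤ B := by
  obtain ⟨B, hB⟩ := ((isCompact_Icc (a := (0 : ℝ)) (b := 2 * π)).prod
    (isCompact_Icc (a := (0 : ℝ)) (b := π))).exists_bound_of_continuousOn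
      p.continuous_harm.continuousOn
  exact ⟨B, fun φ hφ θ hθ => hB (φ, θ) ⟨hφ, hθ⟩⟩

lemma exists_norm_modeGain_sub_le {M : ℕ} (p : Mode M) :
    ∃ A : ℝ, ∀ (r₀ : ℝ) (x : Space), 0 < r₀ → 2 * ‖x‖ ≤ r₀ →
      ‖modeGain r₀ x p - sphereIntegral p.harm‖ ≤ A * (‖x‖ / r₀) := by
  obtain ⟨B, hB⟩ := exists_norm_harm_le p
  refine ⟨2 * B * π * (2 * π), fun r₀ x hr hx => ?_⟩
  rw [modeGain, ← sphereIntegral_sub _ _ (continuous_pathRatio_mul_harm hr hx p) p.continuous_harm]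
  have := norm_sphereIntegral_le (B := 2 * (‖x‖ / r₀) * B)
    (F := fun φ θ => (pathRatio r₀ x φ θ : ℂ) * p.harm φ θ - p.harm φ θ) ?_
  · refine this.trans (le_of_eq ?_)
    ring
  · intro φ hφ θ hθ
    have h1 : (pathRatio r₀ x φ θ : ℂ) * p.harm φ θ - p.harm φ θ =
        ((pathRatio r₀ x φ θ - 1 : ℝ) : ℂ) * p.harm φ θ := by
      push_cast; ring
    rw [h1, norm_mul, Complex.norm_real, Real.norm_eq_abs]
    exact mul_le_mul (abs_pathRatio_sub_one_le hr hx φ θ) (hB φ hφ θ hθ) (norm_nonneg _)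
      (by positivity)

/-- The mode integrals are the entries of √(4π) e₀; the sign (-1)^ℓ is harmless since it equals 1 at
the only nonzero entry. -/
lemma norm_gainVector_sub_apply {M : ℕ} (r₀ : ℝ) (x : Space) (p : Mode M) :
    ‖(gainVector M r₀ x - (√(4 * π) : ℂ) • e₀ M) p‖ =
      ‖modeGain r₀ x p - sphereIntegral p.harm‖ := by
  have h : (gainVector M r₀ x - (√(4 * π) : ℂ) • e₀ M) p =
      (-1) ^ (p.1 : ℕ) * (starRingEnd ℂ) (modeGain r₀ x p - sphereIntegral p.harm) := by
    rw [PiLp.sub_apply, PiLp.smul_apply, e₀, PiLp.single_apply, p.sphereIntegral_harm,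
      gainVector]
    split_ifs with hp
    · subst hp
      simp [Mode.zero]
    · simp
  rw [h, norm_mul, norm_pow, norm_neg, norm_one, one_pow, one_mul, RCLike.norm_conj]

lemma exists_norm_gainVector_sub_le (M : ℕ) :
    ∃ A : ℝ, 0 ≤ A ∧ ∀ (r₀ : ℝ) (x : Space), 0 < r₀ → 2 * ‖x‖ ≤ r₀ →
      ‖gainVector M r₀ x - (√(4 * π) : ℂ) • e₀ M‖ ≤ A * (‖x‖ / r₀) := by
  choose A hA using fun p : Mode M => exists_norm_modeGain_sub_le p
  refine ⟨√(∑ p, A p ^ 2), Real.sqrt_nonneg _, fun r₀ x hr hx => ?_⟩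
  refine le_of_sq_le_sq ?_ (by positivity)
  rw [EuclideanSpace.norm_sq_eq, mul_pow, Real.sq_sqrt (by positivity), Finset.sum_mul]
  refine Finset.sum_le_sum fun p _ => ?_
  rw [norm_gainVector_sub_apply, ← mul_pow]
  gcongr
  exact hA p r₀ x hr hx

lemma norm_sqrt_smul_e₀ (M : ℕ) : ‖(√(4 * π) : ℂ) • e₀ M‖ = √(4 * π) := by
  rw [norm_smul, Complex.norm_real, Real.norm_of_nonneg (Real.sqrt_nonneg _), e₀,
    PiLp.norm_single, norm_one, mul_one]

lemma isGreatest_receiveSNR {U M n : ℕ} {lam Pt σ E r₀ : ℝ} (hPt : 0 < Pt) (hE : 0 ≤ E)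
    (hr : 0 < r₀) (X : Fin U → Space) (u : Fin U) (hX : 2 * ‖X u‖ ≤ r₀)
    (b : OrthonormalBasis (Fin n) ℂ (nullSpace M lam X u)) :
    IsGreatest {s : ℝ | ∃ c : Fin U → Coeff M, Admissible lam E X c ∧
        s = receiveSNR lam Pt σ r₀ X c u}
      (lam ^ 2 * Pt / ((4 * π) ^ 3 * σ ^ 2) *
        (E * ∑ i, ‖inner ℂ (gainVector M r₀ (X u)) (b i : Coeff M)‖ ^ 2)) := by
  have hpi := Real.pi_pos
  obtain ⟨⟨v, hv, hvE, hveq⟩, hub⟩ :=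
    isGreatest_norm_inner_sq (nullSpace M lam X u) b (gainVector M r₀ (X u)) hE
  constructor
  · obtain ⟨c, hc, hcu⟩ := (exists_admissible_iff hE X u (antipodalCoeff v)).2
      (by rw [antipodalCoeff_antipodalCoeff]; exact ⟨hv, hvE⟩)
    refine ⟨c, hc, ?_⟩
    rw [receiveSNR_eq hPt hr X c u hX, hcu, ← inner_gainVector_antipodalCoeff,
      antipodalCoeff_antipodalCoeff, hveq]
  · rintro s ⟨c, hc, rfl⟩
    obtain ⟨h1, h2⟩ := (exists_admissible_iff hE X u (c u)).1 ⟨c, hc, rfl⟩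
    rw [receiveSNR_eq hPt hr X c u hX, ← inner_gainVector_antipodalCoeff]
    gcongr
    exact hub ⟨_, h1, h2, rfl⟩

end SphUA

theorem mainTheorem9 (M : ℕ) (lam Pt σ E : ℝ) (hlam : 0 < lam) (hPt : 0 < Pt) (hσ : 0 < σ)
    (hE : 0 < E) :
    ∃ C : ℝ, ∀ (U : ℕ) (X : Fin U → SphUA.Space) (r₀ : ℝ), 0 < r₀ →
      (∀ k : Fin U, 2 * ‖X k‖ ≤ r₀) →
      ∀ (u : Fin U) (n : ℕ) (b : OrthonormalBasis (Fin n) ℂ (SphUA.nullSpace M lam X u)),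
        ∃ S : ℝ,
          IsGreatest {s : ℝ | ∃ c : Fin U → SphUA.Coeff M, SphUA.Admissible lam E X c ∧
            s = SphUA.receiveSNR lam Pt σ r₀ X c u} S ∧
          |S - (SphUA.eta lam E) ^ 2 * Pt *
              (∑ i : Fin n, ‖inner ℂ (SphUA.e₀ M) (b i : SphUA.Coeff M)‖ ^ 2) / σ ^ 2|
            ≤ C * ((⨆ k : Fin U, ‖X k‖) / r₀) := by
  obtain ⟨A, hA0, hA⟩ := SphUA.exists_norm_gainVector_sub_le M
  set q : ℝ := √(4 * Real.pi) with hq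
  have hq2 : q ^ 2 = 4 * Real.pi := Real.sq_sqrt (by positivity)
  set κ : ℝ := lam ^ 2 * Pt / ((4 * Real.pi) ^ 3 * σ ^ 2) with hκ
  have hκ0 : 0 ≤ κ := by positivity
  -- Here A bounds ‖W - W₀‖ per unit of r_u/r₀, and A + 2q bounds ‖W‖ + ‖W₀‖.
  refine ⟨κ * E * (A * (A + 2 * q)), fun U X r₀ hr hX u n b =>
    ⟨_, SphUA.isGreatest_receiveSNR hPt hE.le hr X u (hX u) b, ?_⟩⟩
  set W := SphUA.gainVector M r₀ (X u)
  set W₀ := (q : ℂ) • SphUA.e₀ M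
  -- The squared factor q² = 4π in W₀ turns κE into η²P_t/σ².
  have hmain : SphUA.eta lam E ^ 2 * Pt *
      (∑ i : Fin n, ‖inner ℂ (SphUA.e₀ M) (b i : SphUA.Coeff M)‖ ^ 2) / σ ^ 2 =
        κ * (E * ∑ i, ‖inner ℂ W₀ (b i : SphUA.Coeff M)‖ ^ 2) := by
    have h1 : ∀ i, ‖inner ℂ W₀ (b i : SphUA.Coeff M)‖ ^ 2 =
        4 * Real.pi * ‖inner ℂ (SphUA.e₀ M) (b i : SphUA.Coeff M)‖ ^ 2 := by
      intro i
      rw [inner_smul_left, norm_mul, mul_pow, RCLike.norm_conj, Complex.norm_real,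
        Real.norm_eq_abs, sq_abs, hq2]
    simp_rw [h1]
    rw [← Finset.mul_sum, SphUA.eta, hκ, div_pow, mul_pow, Real.sq_sqrt hE.le]
    field_simp
  rw [hmain, ← mul_sub, ← mul_sub, ← mul_assoc, abs_mul, abs_of_nonneg (by positivity)]
  have hsup : ‖X u‖ ≤ ⨆ k : Fin U, ‖X k‖ :=
    le_ciSup (f := fun k => ‖X k‖) (Set.finite_range _).bddAbove u
  have hρ1 : ‖X u‖ / r₀ ≤ 1 := by
    rw [div_le_one hr]
    linarith [hX u, norm_nonneg (X u)]
  have hd : ‖W - W₀‖ ≤ A * (‖X u‖ / r₀) := hA r₀ (X u) hr (hX u)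
  have hW₀ : ‖W₀‖ = q := SphUA.norm_sqrt_smul_e₀ M
  have hW : ‖W‖ ≤ A + q := by
    have h1 := norm_le_norm_sub_add W W₀
    have h2 : A * (‖X u‖ / r₀) ≤ A := mul_le_of_le_one_right hA0 hρ1
    linarith
  calc κ * E * |∑ i, ‖inner ℂ W (b i : SphUA.Coeff M)‖ ^ 2 -
        ∑ i, ‖inner ℂ W₀ (b i : SphUA.Coeff M)‖ ^ 2|
      ≤ κ * E * (‖W - W₀‖ * (‖W‖ + ‖W₀‖)) := by
        gcongr
        exact SphUA.abs_sum_norm_inner_sq_sub_le _ b W W₀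
    _ ≤ κ * E * (A * ((⨆ k : Fin U, ‖X k‖) / r₀) * (A + 2 * q)) := by
        have h3 : ‖W - W₀‖ ≤ A * ((⨆ k : Fin U, ‖X k‖) / r₀) := hd.trans (by gcongr)
        have h4 : ‖W‖ + ‖W₀‖ ≤ A + 2 * q := by linarith
        gcongr
        exact (norm_nonneg _).trans h3
    _ = _ := by ring
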